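/- All graphs are finite and simple. A block of a graph is a maximal connected subgraph with no cut-vertex, and a bi-block graph is a connected graph each of whose blocks is a complete bipartite graph $K_{m,n}$ with $m,n\ge 1$. Let $q$ be an element of a commutative ring with $1$ (for example a real number or an indeterminate), and put $[\alpha]=1+q+\cdots+q^{\alpha-1}$ for $\alpha\ge 1$ and $[0]=0$. The $q$-distance matrix of a connected graph $G$ on the vertices $v_1,\dots,v_{\mathbf n}$ is $\mathscr D(G)=([d(v_i,v_j)])_{i,j}$, where $d$ is the shortest-path distance. Let $\xi(\mathscr D(G))$ be the cofactor in position $(1,1)$ of the matrix obtained from $\mathscr D(G)$ by first subtracting the first row from all other rows and then subtracting, for each $j\ge 2$, $q^{d(v_1,v_j)}$ times the first column from the $j$-th column. **Theorem.** Let $G$ be a bi-block graph with exactly $r>1$ blocks $G_i=K_{m_i,n_i}$, $i=1,\dots,r$, and let $q\ne -1$. Then the number of vertices of $G$ is $\mathbf n=\sum_{i=1}^r(m_i+n_i)-r+1$, and, for every ordering of the vertices of $G$ and of its blocks, $$\xi(\mathscr D(G))=\prod_{i=1}^r(-1)^{m_i+n_i-2}(q+1)^{m_i+n_i-1}\left[q^2(m_i-1)(n_i-1)-1\right]$$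 and $$\det\mathscr D(G)=\sum_{i=1}^r\det\mathscr D(G_i)\prod_{j\ne i}\xi(\mathscr D(G_j)),$$ where, for all $i$ and $j$, $$\det\mathscr D(G_i)=(-1)^{m_i+n_i-2}(q+1)^{m_i+n_i-2}\left[(q+1)^2(m_i-1)(n_i-1)-m_in_i\right]$$ and $$\xi(\mathscr D(G_j))=(-1)^{m_j+n_j-2}(q+1)^{m_j+n_j-1}\left[q^2(m_j-1)(n_j-1)-1\right].$$ -/

import Mathlib

namespace SimpleGraph

variable {V : Type*}

/-- A connected subgraph with no cut-vertex: `H` is nonempty and connected, and it is such that deleting any one of its vertices does not disconnect it.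
(A graph without vertices counts as not disconnected, so a single vertex has no cut-vertex.) -/
def Subgraph.IsConnectedWithoutCutVertex {G : SimpleGraph V} (H : G.Subgraph) : Prop :=
  H.Connected ∧ ∀ v ∈ H.verts, (H.deleteVerts {v}).Preconnected

/-- A block of `G`: a maximal connected subgraph with no cut-vertex. -/
def Subgraph.IsBlock {G : SimpleGraph V} (H : G.Subgraph) : Prop :=
  Maximal Subgraph.IsConnectedWithoutCutVertex H

/-- The graph `G` is (isomorphic to) the complete bipartite graph `K_{m,n}`. -/
def IsCompleteBipartiteOn (G : SimpleGraph V) (m n : ℕ) : Prop :=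
  Nonempty (G ≃g completeBipartiteGraph (Fin m) (Fin n))

/-- A bi-block graph: a connected graph each of whose blocks is a complete bipartite graph
`K_{m,n}` (with `m, n ≥ 1`). -/
def IsBiBlock (G : SimpleGraph V) : Prop :=
  G.Connected ∧ ∀ H : G.Subgraph, H.IsBlock →
    ∃ m n : ℕ, 0 < m ∧ 0 < n ∧ H.coe.IsCompleteBipartiteOn m n

variable {R : Type*} [CommRing R]

/-- The `q`-distance matrix: the `(i, j)` entry is `1 + q + ⋯ + q ^ (d(i, j) - 1)`, which is `0`
for `i = j`. -/
noncomputable def qDistMatrix (G : SimpleGraph V) (q : R) : Matrix V V R :=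
  Matrix.of fun i j => ∑ k ∈ Finset.range (G.dist i j), q ^ k

/-- The matrix obtained from the `q`-distance matrix by subtracting the row of `v` from all
other rows. -/
noncomputable def qDistRowReduced [DecidableEq V] (G : SimpleGraph V) (q : R) (v : V) :
    Matrix V V R :=
  Matrix.of fun i j =>
    if i = v then G.qDistMatrix q v j else G.qDistMatrix q i j - G.qDistMatrix q v j

/-- The matrix obtained from the row-reduced matrix by subtracting, for every `j ≠ v`,
`q ^ d(v, j)` times the column of `v` from the column of `j`. -/
noncomputable def qDistReduced [DecidableEq V] (G : SimpleGraph V) (q : R) (v : V) :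
    Matrix V V R :=
  Matrix.of fun i j =>
    if j = v then G.qDistRowReduced q v i v
    else G.qDistRowReduced q v i j - q ^ G.dist v j * G.qDistRowReduced q v i v

/-- The cofactor `ξ` of the `q`-distance matrix, where `v` is the vertex listed first: the
cofactor at position `(v, v)` of the reduced matrix, i.e. the determinant of the matrix that is
left when the row and the column of `v` are deleted. -/
noncomputable def qCofactor [Fintype V] [DecidableEq V] (G : SimpleGraph V) (q : R) (v : V) : R :=
  ((G.qDistReduced q v).submatrix
    (Subtype.val : {w : V // w ≠ v} → V) (Subtype.val : {w : V // w ≠ v} → V)).det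

end SimpleGraph

/-!
The formulas for `ξ` and the determinant are a `q`-version of the Graham–Hoffman–Hosoya theorem,
valid for every connected graph `G` (`Connected.qDistMatrix_blocks`), combined with the evaluation
of both quantities for complete bipartite graphs.

Write `D` for the `q`-distance matrix. Since `q ^ d = 1 + (q - 1) * [d]`, reducing `D` at a vertex
`v` gives the matrix `M i j = D i j - D v j - D i v - (q - 1) * D v j * D i v`, and `ξ` is the
determinant of `M` away from `v`. Two facts make it behave well under gluing. First, `ξ` does not
depend on `v`, because it is up to sign the determinant of `D` bordered by ones with corner
`1 - q` (`Matrix.det_bordered`). Second, if every path from `i` to `j` passes through `v`, then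
`[d(i, v) + d(v, j)] = [d(i, v)] + q ^ d(i, v) * [d(v, j)]` says exactly that `M i j = 0`. So at a
cut-vertex `v` the matrix `M` is block diagonal; `ξ` is multiplicative, and expanding the row of `v`
gives `det D = det D₁ * ξ₂ + ξ₁ * det D₂` (`Matrix.detOn_insert_union_of_qReduce`).

The block decomposition is obtained by induction over geodesically convex sets of vertices, for
which distances agree with those of `G` (`IsGeodesicallyConvex.exists_blocks`). If a convex set has
a cut-vertex, then both sides of the cut are again convex, and the blocks of the whole are the
blocks of the two sides (`IsSplitAt.isBlockIn_iff`).

For `K_{m,n}`, the matrix `D` is a matrix of rank at most two minus `q + 1` times the identity, and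
the reduced matrix is `-(q + 1)` times a perturbation of the identity of rank at most two; both
determinants reduce to `2 × 2` ones.
-/

/-! ### Principal minors and reduced matrices -/

namespace Matrix

variable {V R : Type*} [DecidableEq V] [CommRing R]

/-- The principal minor of `M` with rows and columns in the finite set `S`. -/
def detOn (M : Matrix V V R) (S : Finset V) : R :=
  (M.submatrix (Subtype.val : S → V) Subtype.val).det

/-- A determinant over a type that enumerates `S` without repetition is the principal minor
on `S`. -/
theorem detOn_eq_det {κ : Type*} [Fintype κ] [DecidableEq κ] {M : Matrix V V R} {S : Finset V}
    {N : Matrix κ κ R} (f : κ → V) (hf : Function.Injective f) (hS : ∀ x, x ∈ S ↔ ∃ k, f k = x)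
    (hN : ∀ i j, N i j = M (f i) (f j)) : M.detOn S = N.det := by
  let e : κ ≃ S := Equiv.ofBijective (fun k => ⟨f k, (hS _).2 ⟨k, rfl⟩⟩)
    ⟨fun a b h => hf (congrArg Subtype.val h), fun x => by
      obtain ⟨k, hk⟩ := (hS x).1 x.2
      exact ⟨k, Subtype.ext hk⟩⟩
  rw [detOn, ← det_submatrix_equiv_self e]
  congr 1
  ext i j
  exact (hN i j).symm

theorem detOn_congr {M N : Matrix V V R} {S : Finset V}
    (h : ∀ i ∈ S, ∀ j ∈ S, M i j = N i j) : M.detOn S = N.detOn S := by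
  rw [detOn, detOn]
  congr 1
  ext i j
  exact h i i.2 j j.2

/-- Principal minors of block triangular matrices are multiplicative. -/
theorem detOn_union {M : Matrix V V R} {A C : Finset V} (hAC : Disjoint A C)
    (h : ∀ i ∈ A, ∀ j ∈ C, M i j = 0) : M.detOn (A ∪ C) = M.detOn A * M.detOn C := by
  have hd : ∀ x ∈ A, x ∉ C := fun x hx hc => Finset.disjoint_left.1 hAC hx hc
  rw [detOn, twoBlockTriangular_det _ (fun x : (A ∪ C : Finset V) => x.1 ∈ C), mul_comm]
  · congr 1
    · refine (detOn_eq_det (fun x : {y : (A ∪ C : Finset V) // ¬ y.1 ∈ C} => x.1.1)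
        (fun a b hab => Subtype.ext (Subtype.ext hab)) (fun x => ⟨fun hx => ?_, ?_⟩)
        fun i j => rfl).symm
      · exact ⟨⟨⟨x, Finset.mem_union_left _ hx⟩, hd x hx⟩, rfl⟩
      · rintro ⟨k, rfl⟩
        exact (Finset.mem_union.1 k.1.2).resolve_right k.2
    · refine (detOn_eq_det (fun x : {y : (A ∪ C : Finset V) // y.1 ∈ C} => x.1.1)
        (fun a b hab => Subtype.ext (Subtype.ext hab)) (fun x => ⟨fun hx => ?_, ?_⟩)
        fun i j => rfl).symm
      · exact ⟨⟨⟨x, Finset.mem_union_right _ hx⟩, hx⟩, rfl⟩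
      · rintro ⟨k, rfl⟩
        exact k.2
  · intro i hi j hj
    exact h i ((Finset.mem_union.1 i.2).resolve_right hi) j hj

theorem detOn_updateRow_add (M : Matrix V V R) {S : Finset V} {v : V} (hv : v ∈ S)
    (a b : V → R) :
    (M.updateRow v (a + b)).detOn S = (M.updateRow v a).detOn S + (M.updateRow v b).detOn S := by
  have key : ∀ c : V → R, (M.updateRow v c).submatrix (Subtype.val : S → V) (Subtype.val : S → V) =
      (M.submatrix (Subtype.val : S → V) (Subtype.val : S → V)).updateRow ⟨v, hv⟩
        (fun j => c j.1) := by
    intro c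
    ext i j
    by_cases hi : i = ⟨v, hv⟩
    · subst hi; simp
    · have : i.1 ≠ v := fun h => hi (Subtype.ext h)
      simp [updateRow_ne hi, updateRow_ne this]
  simp only [detOn, key]
  exact det_updateRow_add _ _ _ _

/-- If `M` vanishes at `(v, v)` and is block diagonal off `v`, with blocks `A` and `C`, then its
principal minor on `A ∪ C ∪ {v}` is expanded by splitting the row of `v` along `A` and `C`. -/
theorem detOn_insert_union {M : Matrix V V R} {A C : Finset V} {v : V} (hAC : Disjoint A C)
    (hvA : v ∉ A) (hvC : v ∉ C) (hvv : M v v = 0)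
    (h₁ : ∀ i ∈ A, ∀ j ∈ C, M i j = 0) (h₂ : ∀ i ∈ C, ∀ j ∈ A, M i j = 0) :
    M.detOn (insert v (A ∪ C)) =
      M.detOn (insert v A) * M.detOn C + M.detOn A * M.detOn (insert v C) := by
  have hd : ∀ x ∈ A, x ∉ C := fun x hx hc => Finset.disjoint_left.1 hAC hx hc
  let a : V → R := fun j => if j ∈ C then 0 else M v j
  let c : V → R := fun j => if j ∈ C then M v j else 0
  have hM : M = M.updateRow v (a + c) := by
    ext i j
    by_cases hi : i = v
    · subst hi; by_cases hj : j ∈ C <;> simp [a, c, hj]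
    · simp [updateRow_ne hi]
  have hne : ∀ {S : Finset V} {b : V → R}, v ∉ S → (M.updateRow v b).detOn S = M.detOn S := by
    intro S b hv
    refine detOn_congr fun i hi j _ => ?_
    rw [updateRow_ne (ne_of_mem_of_not_mem hi hv)]
  have hin : ∀ {S : Finset V} {b : V → R}, (∀ j ∈ insert v S, b j = M v j) →
      (M.updateRow v b).detOn (insert v S) = M.detOn (insert v S) := by
    intro S b hb
    refine detOn_congr fun i _ j hj => ?_
    by_cases hi : i = v
    · subst hi; simp [hb j hj]
    · rw [updateRow_ne hi]
  conv_lhs => rw [hM]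
  rw [detOn_updateRow_add M (Finset.mem_insert_self _ _)]
  congr 1
  · rw [← Finset.insert_union, detOn_union, hne hvC, hin]
    · intro j hj
      have : j ∉ C := by
        rcases Finset.mem_insert.1 hj with rfl | hj
        exacts [hvC, hd j hj]
      simp [a, this]
    · rw [Finset.disjoint_insert_left]; exact ⟨hvC, hAC⟩
    · intro i hi j hj
      rcases Finset.mem_insert.1 hi with rfl | hi
      · simp [a, hj]
      · rw [updateRow_ne (ne_of_mem_of_not_mem hi hvA)]; exact h₁ i hi j hj
  · rw [Finset.union_comm, ← Finset.insert_union, detOn_union, hne hvA, hin, mul_comm]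
    · intro j hj
      rcases Finset.mem_insert.1 hj with rfl | hj
      · simp [c, hvC, hvv]
      · simp [c, hj]
    · rw [Finset.disjoint_insert_left]; exact ⟨hvA, hAC.symm⟩
    · intro i hi j hj
      rcases Finset.mem_insert.1 hi with rfl | hi
      · simp [c, hd j hj]
      · rw [updateRow_ne (ne_of_mem_of_not_mem hi hvC)]; exact h₂ i hi j hj

/-- The matrix `D` after subtracting the row of `v` from all other rows and then
`1 + (q - 1) * D v j` times the column of `v` from every other column `j`, away from the row and
the column of `v`. If `D` is a `q`-distance matrix, the factor is `q ^ d(v, j)`. -/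
def qReduce (D : Matrix V V R) (q : R) (v : V) : Matrix V V R :=
  of fun i j => D i j - D v j - (1 + (q - 1) * D v j) * D i v

/-- For `D v v = 0`, the cofactor of the reduced matrix at `v` is, up to sign, the determinant of
`D` bordered by ones with corner `1 - q`: the rows and columns of the border and of `v` span an
invertible `2 × 2` block, whose Schur complement is the reduced matrix. -/
theorem det_bordered {ι : Type*} [Fintype ι] [DecidableEq ι] (D : Matrix ι ι R) (q : R) (v : ι)
    (hv : D v v = 0) :
    (fromBlocks (of fun _ _ : Unit => 1 - q) (of fun _ _ => 1) (of fun _ _ => 1) D).det =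
      -((D.qReduce q v).submatrix (Subtype.val : {w // w ≠ v} → ι) Subtype.val).det := by
  let f : Fin 2 ⊕ {w // w ≠ v} → Unit ⊕ ι :=
    Sum.elim ![Sum.inl (), Sum.inr v] (fun w => Sum.inr w.1)
  have hf : Function.Bijective f := by
    constructor
    · rintro (a | a) (b | b) h
      · fin_cases a <;> fin_cases b <;> simp_all [f]
      · fin_cases a
        · simp [f] at h
        · exact absurd (Sum.inr_injective h).symm b.2
      · fin_cases b
        · simp [f] at h
        · exact absurd (Sum.inr_injective h) a.2
      · exact congrArg Sum.inr (Subtype.ext (Sum.inr_injective h))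
    · rintro (a | a)
      · exact ⟨Sum.inl 0, rfl⟩
      · by_cases ha : a = v
        · exact ⟨Sum.inl 1, by simp [f, ha]⟩
        · exact ⟨Sum.inr ⟨a, ha⟩, rfl⟩
  rw [← det_submatrix_equiv_self (Equiv.ofBijective f hf)]
  let A : Matrix (Fin 2) (Fin 2) R := !![1 - q, 1; 1, 0]
  let A' : Matrix (Fin 2) (Fin 2) R := !![0, 1; 1, q - 1]
  let _ : Invertible A := ⟨A', by simp [A, A', one_fin_two], by simp [A, A', one_fin_two]⟩
  have hA' : ⅟A = A' := rfl
  let B : Matrix (Fin 2) {w // w ≠ v} R := of fun k j => (![1, D v j] : Fin 2 → R) k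
  let C : Matrix {w // w ≠ v} (Fin 2) R := of fun i k => (![1, D i v] : Fin 2 → R) k
  have hblocks : (fromBlocks (of fun _ _ : Unit => 1 - q) (of fun _ _ => 1) (of fun _ _ => 1)
      D).submatrix (Equiv.ofBijective f hf) (Equiv.ofBijective f hf) =
      fromBlocks A B C (D.submatrix Subtype.val Subtype.val) := by
    ext (i | i) (j | j)
    · fin_cases i <;> fin_cases j <;> simp [f, A, hv]
    · fin_cases i <;> simp [f, B]
    · fin_cases j <;> simp [f, C]
    · simp [f]
  rw [hblocks, det_fromBlocks₁₁, hA']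
  have hA : A.det = -1 := by simp [A, det_fin_two]
  rw [hA, neg_one_mul]
  congr 2
  ext i j
  simp [A', B, C, mul_apply, Fin.sum_univ_two, qReduce]
  ring

theorem detOn_qReduce_erase (D : Matrix V V R) (q : R) {S : Finset V} {v : V} (hv : v ∈ S) :
    (D.qReduce q v).detOn (S.erase v) =
      (((D.submatrix (Subtype.val : S → V) Subtype.val).qReduce q ⟨v, hv⟩).submatrix
        (Subtype.val : {w // w ≠ (⟨v, hv⟩ : S)} → S) Subtype.val).det := by
  refine detOn_eq_det (fun x => x.1.1)
    (fun a b hab => Subtype.ext (Subtype.ext hab)) (fun x => ⟨fun hx => ?_, ?_⟩) fun i j => rfl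
  · obtain ⟨hne, hx⟩ := Finset.mem_erase.1 hx
    exact ⟨⟨⟨x, hx⟩, fun h => hne (congrArg Subtype.val h)⟩, rfl⟩
  · rintro ⟨k, rfl⟩
    exact Finset.mem_erase.2 ⟨fun h => k.2 (Subtype.ext h), k.1.2⟩

/-- The cofactor of the reduced matrix does not depend on the pivot vertex. -/
theorem detOn_qReduce_erase_eq {D : Matrix V V R} (hD : ∀ i, D i i = 0) (q : R) {S : Finset V}
    {v w : V} (hv : v ∈ S) (hw : w ∈ S) :
    (D.qReduce q v).detOn (S.erase v) = (D.qReduce q w).detOn (S.erase w) := by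
  let D' : Matrix S S R := D.submatrix Subtype.val Subtype.val
  rw [detOn_qReduce_erase D q hv, detOn_qReduce_erase D q hw, ← neg_inj,
    ← det_bordered D' q ⟨v, hv⟩ (hD v), ← det_bordered D' q ⟨w, hw⟩ (hD w)]

/-- The reduction of `D` at `v`, with the row and the column of `v` kept. -/
def qReduceFull (D : Matrix V V R) (q : R) (v : V) : Matrix V V R :=
  of fun i j => if i = v ∨ j = v then D i j else D.qReduce q v i j

theorem detOn_qReduceFull (D : Matrix V V R) (q : R) {S : Finset V} {v : V} (hv : v ∈ S)
    (hD : D v v = 0) : (D.qReduceFull q v).detOn S = D.detOn S := by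
  let B : Matrix V V R := of fun i j => if i = v then D v j else D i j - D v j
  -- `B` is the matrix after the row operations only; the column operations are row operations on
  -- the transposes.
  trans B.detOn S
  · rw [detOn, detOn, ← det_transpose, ← det_transpose (submatrix B _ _)]
    refine det_eq_of_forall_row_eq_smul_add_const
      (fun j : S => if j.1 = v then 0 else -(1 + (q - 1) * D v j)) ⟨v, hv⟩ (by simp) ?_
    intro j i
    by_cases hi : i.1 = v <;> by_cases hj : j.1 = v <;>
      (simp [qReduceFull, qReduce, B, hi, hj, hD]; try ring)
  · refine det_eq_of_forall_row_eq_smul_add_const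
      (fun i : S => if i.1 = v then 0 else -1) ⟨v, hv⟩ (by simp) ?_
    intro i j
    by_cases hi : i.1 = v
    · simp [B, hi]
    · simp [B, hi]; ring

/-- Gluing at `v`: if the reduced matrix at `v` is block diagonal with blocks `A` and `C`, then
principal minors of `D` satisfy the Graham–Hoffman–Hosoya identity. -/
theorem detOn_insert_union_of_qReduce {D : Matrix V V R} (q : R) {A C : Finset V} {v : V}
    (hAC : Disjoint A C) (hvA : v ∉ A) (hvC : v ∉ C) (hD : D v v = 0)
    (h₁ : ∀ i ∈ A, ∀ j ∈ C, D.qReduce q v i j = 0)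
    (h₂ : ∀ i ∈ C, ∀ j ∈ A, D.qReduce q v i j = 0) :
    D.detOn (insert v (A ∪ C)) =
      D.detOn (insert v A) * (D.qReduce q v).detOn C +
        (D.qReduce q v).detOn A * D.detOn (insert v C) := by
  have hE : ∀ i ≠ v, ∀ j ≠ v, D.qReduceFull q v i j = D.qReduce q v i j := fun i hi j hj => by
    simp [qReduceFull, hi, hj]
  have hsub : ∀ {S : Finset V}, v ∉ S → (D.qReduceFull q v).detOn S = (D.qReduce q v).detOn S :=
    fun {S} hS => detOn_congr fun i hi j hj =>
      hE i (fun h => hS (h ▸ hi)) j (fun h => hS (h ▸ hj))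
  rw [← detOn_qReduceFull D q (Finset.mem_insert_self v _) hD,
    ← detOn_qReduceFull D q (Finset.mem_insert_self v A) hD,
    ← detOn_qReduceFull D q (Finset.mem_insert_self v C) hD, ← hsub hvA, ← hsub hvC]
  refine detOn_insert_union hAC hvA hvC (by simp [qReduceFull, hD]) ?_ ?_
  · intro i hi j hj
    rw [hE i (fun h => hvA (h ▸ hi)) j (fun h => hvC (h ▸ hj)), h₁ i hi j hj]
  · intro i hi j hj
    rw [hE i (fun h => hvC (h ▸ hi)) j (fun h => hvA (h ▸ hj)), h₂ i hi j hj]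

end Matrix

/-! ### Geodesically convex sets -/

namespace SimpleGraph

open Matrix

variable {V : Type*} {G : SimpleGraph V}

theorem Connected.exists_adj_dist_add_one (hG : G.Connected) {x y : V} (h : x ≠ y) :
    ∃ z, G.Adj x z ∧ G.dist z y + 1 = G.dist x y := by
  obtain ⟨p, hp⟩ := hG.exists_walk_length_eq_dist x y
  cases p with
  | nil => exact absurd rfl h
  | @cons _ z _ hz p =>
    refine ⟨z, hz, ?_⟩
    have h₁ := dist_le p
    have h₂ := hG.dist_triangle (u := x) (v := z) (w := y)
    have h₃ := dist_eq_one_iff_adj.2 hz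
    rw [Walk.length_cons] at hp
    omega

/-- A finite set of vertices is geodesically convex if it contains every vertex that lies on a
shortest path between two of its members. -/
def IsGeodesicallyConvex (G : SimpleGraph V) (S : Finset V) : Prop :=
  ∀ x ∈ S, ∀ y ∈ S, ∀ z, G.dist x z + G.dist z y = G.dist x y → z ∈ S

/-- Shortest paths between members of a convex set stay inside its induced subgraph. -/
theorem IsGeodesicallyConvex.exists_walk (hG : G.Connected) {S : Finset V}
    (hS : G.IsGeodesicallyConvex S) (x y : ((⊤ : G.Subgraph).induce S).verts) :
    ∃ p : ((⊤ : G.Subgraph).induce S).coe.Walk x y, p.length = G.dist x y := by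
  induction hn : G.dist x.1 y.1 generalizing x with
  | zero =>
    obtain rfl : x = y := Subtype.ext (hG.dist_eq_zero_iff.1 hn)
    exact ⟨.nil, rfl⟩
  | succ n ih =>
    have hxy : x.1 ≠ y.1 := fun h => by rw [h, dist_self] at hn; omega
    obtain ⟨z, hxz, hz⟩ := hG.exists_adj_dist_add_one hxy
    have hzS : z ∈ S := hS x x.2 y y.2 z (by rw [dist_eq_one_iff_adj.2 hxz]; omega)
    obtain ⟨p, hp⟩ := ih ⟨z, hzS⟩ (by simp only; omega)
    exact ⟨.cons (show ((⊤ : G.Subgraph).induce S).coe.Adj x ⟨z, hzS⟩ from ⟨x.2, hzS, hxz⟩) p,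
      by simp [hp]⟩

theorem IsGeodesicallyConvex.connected (hG : G.Connected) {S : Finset V}
    (hS : G.IsGeodesicallyConvex S) (hne : S.Nonempty) :
    ((⊤ : G.Subgraph).induce S).Connected := by
  obtain ⟨x, hx⟩ := hne
  have : Nonempty ((⊤ : G.Subgraph).induce S).verts := ⟨⟨x, hx⟩⟩
  exact ⟨⟨fun x y => (hS.exists_walk hG x y).elim fun p _ => ⟨p⟩⟩⟩

theorem IsGeodesicallyConvex.dist_coe (hG : G.Connected) {S : Finset V}
    (hS : G.IsGeodesicallyConvex S) (x y : ((⊤ : G.Subgraph).induce S).verts) :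
    ((⊤ : G.Subgraph).induce S).coe.dist x y = G.dist x y := by
  obtain ⟨p, hp⟩ := hS.exists_walk hG x y
  obtain ⟨p', hp'⟩ := Reachable.exists_walk_length_eq_dist ⟨p⟩
  refine le_antisymm (hp ▸ dist_le p) ?_
  have := dist_le (p'.map (Subgraph.hom _))
  rwa [Walk.length_map, hp'] at this

/-! ### Entries of the `q`-distance matrix -/

theorem qDistMatrix_self {R : Type*} [CommRing R] (q : R) (v : V) : G.qDistMatrix q v v = 0 := by
  simp [qDistMatrix]

theorem one_add_mul_qDistMatrix {R : Type*} [CommRing R] (q : R) (v w : V) :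
    1 + (q - 1) * G.qDistMatrix q v w = q ^ G.dist v w := by
  rw [qDistMatrix, of_apply, mul_geom_sum]; ring

theorem qDistMatrix_eq_of_dist_eq_add {R : Type*} [CommRing R] (q : R) {x y v : V}
    (h : G.dist x y = G.dist x v + G.dist v y) :
    G.qDistMatrix q x y =
      G.qDistMatrix q x v + q ^ G.dist x v * G.qDistMatrix q v y := by
  simp only [qDistMatrix, of_apply, h, Finset.sum_range_add, pow_add, Finset.mul_sum]

/-! ### Splitting at a cut-vertex -/

/-- `v`, `A` and `C` are disjoint, and no edge joins `A` to `C`: in the subgraph induced on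
`A ∪ C ∪ {v}`, the vertex `v` separates `A` from `C`. -/
structure IsSplitAt (G : SimpleGraph V) (v : V) (A C : Finset V) : Prop where
  disjoint : Disjoint A C
  notMem_left : v ∉ A
  notMem_right : v ∉ C
  not_adj : ∀ x ∈ A, ∀ y ∈ C, ¬ G.Adj x y

theorem IsSplitAt.symm {v : V} {A C : Finset V} (h : G.IsSplitAt v A C) : G.IsSplitAt v C A :=
  ⟨h.disjoint.symm, h.notMem_right, h.notMem_left, fun x hx y hy hxy => h.not_adj y hy x hx hxy.symm⟩

theorem isConnectedWithoutCutVertex_subgraphOfAdj {x y : V} (h : G.Adj x y) :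
    (G.subgraphOfAdj h).IsConnectedWithoutCutVertex := by
  refine ⟨Subgraph.subgraphOfAdj_connected h, fun w hw => ⟨fun a b => ?_⟩⟩
  have : a = b := by
    obtain ⟨a, ha⟩ := a
    obtain ⟨b, hb⟩ := b
    simp only [Subgraph.deleteVerts_verts, subgraphOfAdj_verts, Set.mem_sdiff, Set.mem_insert_iff,
      Set.mem_singleton_iff] at ha hb hw
    refine Subtype.ext ?_
    simp only
    grind
  rw [this]

variable [DecidableEq V]

/-- A cut-vertex of an induced subgraph splits its vertex set. -/
theorem exists_isSplitAt {S : Finset V} {v : V} (hv : v ∈ S)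
    (h : ¬ (((⊤ : G.Subgraph).induce S).deleteVerts {v}).Preconnected) :
    ∃ A C : Finset V, G.IsSplitAt v A C ∧ A.Nonempty ∧ C.Nonempty ∧ S = insert v (A ∪ C) := by
  classical
  set K := ((⊤ : G.Subgraph).induce S).deleteVerts {v} with hK
  have hKv : ∀ x, x ∈ K.verts ↔ x ∈ S ∧ x ≠ v := fun x => by simp [hK]
  obtain ⟨a, b, hab⟩ : ∃ a b : K.verts, ¬ K.coe.Reachable a b := by
    by_contra! hc
    exact h ⟨hc⟩
  -- `A` is the component of `a` after the deletion of `v`; it does not contain `b`.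
  let A := S.filter fun x => ∃ hx : x ∈ K.verts, K.coe.Reachable a ⟨x, hx⟩
  have hA : ∀ x, x ∈ A ↔ ∃ hx : x ∈ K.verts, K.coe.Reachable a ⟨x, hx⟩ := fun x => by
    simp only [A, Finset.mem_filter, and_iff_right_iff_imp]
    rintro ⟨hx, -⟩
    exact ((hKv x).1 hx).1
  let C := (S \ A).erase v
  have hvA : v ∉ A := fun hvA => ((hKv v).1 ((hA v).1 hvA).1).2 rfl
  refine ⟨A, C, ⟨?_, hvA, by simp [C], ?_⟩, ⟨a, (hA _).2 ⟨a.2, .rfl⟩⟩, ⟨b, ?_⟩, ?_⟩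
  · exact Finset.disjoint_left.2 fun x hx hc =>
      (Finset.mem_sdiff.1 (Finset.mem_of_mem_erase hc)).2 hx
  · intro x hx y hy hxy
    obtain ⟨hyv, hy⟩ := Finset.mem_erase.1 hy
    obtain ⟨hyS, hyA⟩ := Finset.mem_sdiff.1 hy
    obtain ⟨hxK, hx⟩ := (hA x).1 hx
    have hyK : y ∈ K.verts := (hKv y).2 ⟨hyS, hyv⟩
    refine hyA ((hA y).2 ⟨hyK, hx.trans (Adj.reachable ?_)⟩)
    have hxS := (hKv x).1 hxK
    simp [hK, hxS.1, hxS.2, hyS, hyv, hxy]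
  · have hb := (hKv b).1 b.2
    exact Finset.mem_erase.2 ⟨hb.2, Finset.mem_sdiff.2 ⟨hb.1, fun h => hab ((hA _).1 h).2⟩⟩
  · ext x
    by_cases hxv : x = v
    · simp [hxv, hv]
    · have : x ∈ A → x ∈ S := fun h => ((hKv x).1 ((hA x).1 h).1).1
      simp only [C, Finset.mem_insert, Finset.mem_union, Finset.mem_erase, Finset.mem_sdiff]
      tauto

section Split

variable {v : V} {A C : Finset V}

/-- In a split convex set, shortest paths from one side to the other pass through `v`. -/
theorem IsSplitAt.dist_eq_add (hG : G.Connected) (h : G.IsSplitAt v A C)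
    (hS : G.IsGeodesicallyConvex (insert v (A ∪ C))) {x y : V} (hx : x ∈ A) (hy : y ∈ C) :
    G.dist x y = G.dist x v + G.dist v y := by
  induction hn : G.dist x y generalizing x with
  | zero =>
    rw [hG.dist_eq_zero_iff.1 hn] at hx
    exact absurd hy (Finset.disjoint_left.1 h.disjoint hx)
  | succ n ih =>
    have hxy : x ≠ y := fun h => by rw [h, dist_self] at hn; omega
    obtain ⟨z, hxz, hz⟩ := hG.exists_adj_dist_add_one hxy
    have h1 := dist_eq_one_iff_adj.2 hxz
    have hzS := hS x (by simp [hx]) y (by simp [hy]) z (by omega)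
    have t1 := hG.dist_triangle (u := x) (v := v) (w := y)
    have t2 := hG.dist_triangle (u := x) (v := z) (w := v)
    rcases Finset.mem_insert.1 hzS with rfl | hzS
    · omega
    · rcases Finset.mem_union.1 hzS with hzA | hzC
      · have := ih hzA (by omega)
        omega
      · exact absurd hxz (h.not_adj x hx z hzC)

/-- Each side of a split convex set is convex: a shortest path between two vertices of one side
that enters the other side would pass through `v` twice. -/
theorem IsSplitAt.isGeodesicallyConvex (hG : G.Connected) (h : G.IsSplitAt v A C)
    (hS : G.IsGeodesicallyConvex (insert v (A ∪ C))) : G.IsGeodesicallyConvex (insert v A) := by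
  intro x hx y hy z hz
  have hsub : insert v A ⊆ insert v (A ∪ C) :=
    Finset.insert_subset_insert _ Finset.subset_union_left
  have hzS := hS x (hsub hx) y (hsub hy) z hz
  rw [← Finset.insert_union, Finset.mem_union] at hzS
  refine hzS.resolve_right fun hzC => h.notMem_right ?_
  have key : ∀ w ∈ insert v A, G.dist w z = G.dist w v + G.dist v z := by
    intro w hw
    rcases Finset.mem_insert.1 hw with rfl | hw
    · simp
    · exact h.dist_eq_add hG hS hw hzC
  have h1 := key x hx
  have h2 := key y hy
  rw [dist_comm (u := z)] at hz
  rw [dist_comm (u := y) (v := v)] at h2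
  rw [dist_comm (u := y) (v := z), dist_comm (u := z)] at h2
  have t := hG.dist_triangle (u := x) (v := v) (w := y)
  have : G.dist v z = 0 := by omega
  rwa [hG.dist_eq_zero_iff.1 this]

theorem IsSplitAt.not_preconnected (h : G.IsSplitAt v A C) {H : G.Subgraph}
    (hH : ∀ x ∈ H.verts, x ∈ A ∪ C) {a c : V} (ha : a ∈ H.verts) (hc : c ∈ H.verts) (haA : a ∈ A)
    (hcC : c ∈ C) : ¬ H.Preconnected := by
  intro hpre
  obtain ⟨p⟩ := hpre.coe ⟨a, ha⟩ ⟨c, hc⟩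
  have key : ∀ {x y : H.verts}, H.coe.Walk x y → x.1 ∈ A → y.1 ∈ A := by
    intro x y p
    induction p with
    | nil => exact id
    | @cons x z y hxz p ih =>
      intro hx
      refine ih ((Finset.mem_union.1 (hH z z.2)).resolve_right fun hz => ?_)
      exact h.not_adj _ hx _ hz (H.adj_sub hxz)
  exact Finset.disjoint_left.1 h.disjoint (key p haA) hcC

/-- A connected subgraph with no cut-vertex lies on one side of a split: otherwise deleting `v`
would disconnect it. -/
theorem IsSplitAt.verts_subset (h : G.IsSplitAt v A C) {H : G.Subgraph}
    (hH : H.IsConnectedWithoutCutVertex) (hS : H.verts ⊆ (insert v (A ∪ C) : Finset V)) :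
    H.verts ⊆ (insert v A : Finset V) ∨ H.verts ⊆ (insert v C : Finset V) := by
  by_contra! hcon
  obtain ⟨hcA, hcC⟩ := hcon
  obtain ⟨c, hc, hc'⟩ := Set.not_subset.1 hcA
  obtain ⟨a, ha, ha'⟩ := Set.not_subset.1 hcC
  have h1 := hS hc
  have h2 := hS ha
  simp only [Finset.coe_insert, Finset.coe_union, Set.mem_insert_iff, Set.mem_union,
    Finset.mem_coe, not_or] at h1 h2 hc' ha'
  have hcC : c ∈ C := by tauto
  have haA : a ∈ A := by tauto
  have hmem : ∀ x ∈ H.verts, x ≠ v → x ∈ A ∪ C := fun x hx hxv =>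
    (Finset.mem_insert.1 (hS hx)).resolve_left hxv
  by_cases hv : v ∈ H.verts
  · refine h.not_preconnected (H := H.deleteVerts {v}) ?_ (a := a) (c := c) ?_ ?_ haA hcC
      (hH.2 v hv)
    · intro x hx
      simp only [Subgraph.deleteVerts_verts, Set.mem_sdiff, Set.mem_singleton_iff] at hx
      exact hmem x hx.1 hx.2
    · simp [ha, ha'.1]
    · simp [hc, hc'.1]
  · exact h.not_preconnected (fun x hx => hmem x hx (ne_of_mem_of_not_mem hx hv)) ha hc haA hcC
      hH.1.preconnected

end Split

/-! ### Blocks relative to a set of vertices -/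

/-- A block relative to `S`: a maximal connected subgraph with no cut-vertex among those with
vertices in `S`. -/
def IsBlockIn (G : SimpleGraph V) (S : Finset V) (H : G.Subgraph) : Prop :=
  Maximal (fun H : G.Subgraph => H.IsConnectedWithoutCutVertex ∧ H.verts ⊆ S) H

/-- A block relative to a convex set with a second vertex is not a single vertex. -/
theorem IsBlockIn.not_verts_subset_singleton (hG : G.Connected) {v : V} {A : Finset V}
    (hv : v ∉ A) (hA : A.Nonempty) (hS : G.IsGeodesicallyConvex (insert v A)) {H : G.Subgraph}
    (hH : G.IsBlockIn (insert v A) H) : ¬ H.verts ⊆ {v} := by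
  intro hsub
  obtain ⟨a, ha⟩ := hA
  have hva : v ≠ a := fun h => hv (h ▸ ha)
  obtain ⟨z, hvz, hz⟩ := hG.exists_adj_dist_add_one hva
  have hzS : z ∈ insert v A := hS v (by simp) a (by simp [ha]) z
    (by rw [dist_eq_one_iff_adj.2 hvz]; omega)
  -- The edge `v z` is a connected subgraph with no cut-vertex that properly contains `H`.
  have hle : H ≤ G.subgraphOfAdj hvz := by
    refine ⟨fun x hx => by simp [Set.mem_singleton_iff.1 (hsub hx)], fun x y hxy => ?_⟩
    have h1 := Set.mem_singleton_iff.1 (hsub hxy.fst_mem)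
    have h2 := Set.mem_singleton_iff.1 (hsub hxy.snd_mem)
    exact absurd (h1.trans h2.symm) hxy.ne
  have hz' : z ∈ H.verts := (hH.2 ⟨isConnectedWithoutCutVertex_subgraphOfAdj hvz, by
    intro x hx
    rcases hx with rfl | rfl
    · simp
    · exact hzS⟩ hle).1 (by simp)
  exact hvz.ne (Set.mem_singleton_iff.1 (hsub hz')).symm

/-- The blocks relative to a convex set that is split at `v` are those of the two sides. -/
theorem IsSplitAt.isBlockIn_iff (hG : G.Connected) {v : V} {A C : Finset V}
    (h : G.IsSplitAt v A C) (hA : A.Nonempty) (hC : C.Nonempty)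
    (hS : G.IsGeodesicallyConvex (insert v (A ∪ C))) (H : G.Subgraph) :
    G.IsBlockIn (insert v (A ∪ C)) H ↔ G.IsBlockIn (insert v A) H ∨ G.IsBlockIn (insert v C) H := by
  have restrict : ∀ {S T : Finset V}, T ⊆ S → G.IsBlockIn S H → H.verts ⊆ T → G.IsBlockIn T H :=
    fun hTS hH hHT => ⟨⟨hH.1.1, hHT⟩, fun K hK hle =>
      hH.2 ⟨hK.1, hK.2.trans (Finset.coe_subset.2 hTS)⟩ hle⟩
  have extend : ∀ {A C : Finset V}, G.IsSplitAt v A C → A.Nonempty →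
      G.IsGeodesicallyConvex (insert v (A ∪ C)) → G.IsBlockIn (insert v A) H →
      G.IsBlockIn (insert v (A ∪ C)) H := by
    intro A C h hA hS hH
    refine ⟨⟨hH.1.1, hH.1.2.trans (Finset.coe_subset.2
      (Finset.insert_subset_insert _ Finset.subset_union_left))⟩, fun K hK hle => ?_⟩
    rcases h.verts_subset hK.1 hK.2 with hKA | hKC
    · exact hH.2 ⟨hK.1, hKA⟩ hle
    -- If `K` lies on the other side, then `H ≤ K` has no vertex other than `v`.
    · refine absurd (fun x hx => ?_)
        (hH.not_verts_subset_singleton hG h.notMem_left hA (h.isGeodesicallyConvex hG hS))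
      have h1 := Finset.mem_insert.1 (hH.1.2 hx)
      have h2 := Finset.mem_insert.1 (hKC (hle.1 hx))
      rcases h1 with h1 | h1
      · exact h1
      · exact h2.resolve_right (Finset.disjoint_left.1 h.disjoint h1)
  constructor
  · intro hH
    rcases h.verts_subset hH.1.1 hH.1.2 with hHA | hHC
    · exact .inl (restrict (Finset.insert_subset_insert _ Finset.subset_union_left) hH hHA)
    · exact .inr (restrict (Finset.insert_subset_insert _ Finset.subset_union_right) hH hHC)
  · rintro (hH | hH)
    · exact extend h hA hS hH
    · rw [Finset.union_comm] at hS ⊢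
      exact extend h.symm hC hS hH

/-! ### Gluing of determinants and cofactors -/

section Determinants

variable {R : Type*} [CommRing R]

theorem IsSplitAt.qReduce_eq_zero (hG : G.Connected) {v : V} {A C : Finset V}
    (h : G.IsSplitAt v A C) (hS : G.IsGeodesicallyConvex (insert v (A ∪ C))) (q : R) {x y : V}
    (hx : x ∈ A) (hy : y ∈ C) : (G.qDistMatrix q).qReduce q v x y = 0 := by
  rw [qReduce, of_apply, qDistMatrix_eq_of_dist_eq_add q (h.dist_eq_add hG hS hx hy),
    ← one_add_mul_qDistMatrix]
  ring

/-- The cofactor `ξ` of the principal submatrix of the `q`-distance matrix on `S`, with pivot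
`v`. -/
noncomputable def qCofactorOn (G : SimpleGraph V) (q : R) (S : Finset V) (v : V) : R :=
  ((G.qDistMatrix q).qReduce q v).detOn (S.erase v)

theorem qCofactorOn_eq (q : R) {S : Finset V} {v w : V} (hv : v ∈ S) (hw : w ∈ S) :
    G.qCofactorOn q S v = G.qCofactorOn q S w :=
  detOn_qReduce_erase_eq (qDistMatrix_self q) q hv hw

theorem qCofactorOn_insert {v : V} {A : Finset V} (q : R) (hv : v ∉ A) :
    G.qCofactorOn q (insert v A) v = ((G.qDistMatrix q).qReduce q v).detOn A := by
  rw [qCofactorOn, Finset.erase_insert hv]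

theorem IsSplitAt.qCofactorOn (hG : G.Connected) {v : V} {A C : Finset V}
    (h : G.IsSplitAt v A C) (hS : G.IsGeodesicallyConvex (insert v (A ∪ C))) (q : R) :
    G.qCofactorOn q (insert v (A ∪ C)) v =
      G.qCofactorOn q (insert v A) v * G.qCofactorOn q (insert v C) v := by
  rw [qCofactorOn_insert q h.notMem_left, qCofactorOn_insert q h.notMem_right,
    qCofactorOn_insert q (by simp [h.notMem_left, h.notMem_right])]
  exact detOn_union h.disjoint fun x hx y hy => h.qReduce_eq_zero hG hS q hx hy

theorem IsSplitAt.detOn (hG : G.Connected) {v : V} {A C : Finset V}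
    (h : G.IsSplitAt v A C) (hS : G.IsGeodesicallyConvex (insert v (A ∪ C))) (q : R) :
    (G.qDistMatrix q).detOn (insert v (A ∪ C)) =
      (G.qDistMatrix q).detOn (insert v A) * G.qCofactorOn q (insert v C) v +
        G.qCofactorOn q (insert v A) v * (G.qDistMatrix q).detOn (insert v C) := by
  rw [qCofactorOn_insert q h.notMem_left, qCofactorOn_insert q h.notMem_right]
  refine detOn_insert_union_of_qReduce q h.disjoint h.notMem_left h.notMem_right
    (qDistMatrix_self q v) (fun x hx y hy => h.qReduce_eq_zero hG hS q hx hy)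
    fun x hx y hy => h.symm.qReduce_eq_zero hG ?_ q hx hy
  rwa [Finset.union_comm]

/-- The Graham–Hoffman–Hosoya theorem for `q`-distances, relative to a convex set `S` of vertices
of a connected graph: the set `𝔅` of the vertex sets of the blocks determines the cardinality,
the cofactor `ξ` and the determinant. The proof is by induction on `S`: either `S` is itself a
block, or it is split at a cut-vertex. -/
theorem IsGeodesicallyConvex.exists_blocks (hG : G.Connected) (q : R) (S : Finset V)
    (hS : G.IsGeodesicallyConvex S) (hne : S.Nonempty) :
    ∃ 𝔅 : Finset (Finset V),
      (∀ H, G.IsBlockIn S H ↔ ∃ T ∈ 𝔅, H = (⊤ : G.Subgraph).induce T) ∧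
      (∀ T ∈ 𝔅, G.IsGeodesicallyConvex T) ∧
      S.card + 𝔅.card = ∑ T ∈ 𝔅, T.card + 1 ∧
      ∀ u : Finset V → V, (∀ T ∈ 𝔅, u T ∈ T) →
        (∀ v ∈ S, G.qCofactorOn q S v = ∏ T ∈ 𝔅, G.qCofactorOn q T (u T)) ∧
        (G.qDistMatrix q).detOn S = ∑ T ∈ 𝔅, (G.qDistMatrix q).detOn T *
          ∏ T' ∈ 𝔅.erase T, G.qCofactorOn q T' (u T') := by
  classical
  induction hn : S.card using Nat.strong_induction_on generalizing S with
  | _ n ih =>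
  subst hn
  by_cases hcut : ((⊤ : G.Subgraph).induce S).IsConnectedWithoutCutVertex
  · refine ⟨{S}, fun H => ?_, by simpa using hS, by simp, fun u hu => ⟨fun v hv => ?_, by simp⟩⟩
    · have hle : ∀ {K : G.Subgraph}, K.verts ⊆ S → K ≤ (⊤ : G.Subgraph).induce S := fun hK =>
        ⟨hK, fun x y hxy => ⟨hK hxy.fst_mem, hK hxy.snd_mem, hxy.adj_sub⟩⟩
      simp only [Finset.mem_singleton, exists_eq_left]
      constructor
      · exact fun hH => le_antisymm (hle hH.1.2) (hH.2 ⟨hcut, subset_rfl⟩ (hle hH.1.2))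
      · rintro rfl
        exact ⟨⟨hcut, subset_rfl⟩, fun K hK _ => hle hK.2⟩
    · rw [Finset.prod_singleton]
      exact qCofactorOn_eq q hv (hu S (by simp))
  · obtain ⟨v, hv, hcut⟩ : ∃ v ∈ S, ¬ (((⊤ : G.Subgraph).induce S).deleteVerts {v}).Preconnected := by
      by_contra! hc
      exact hcut ⟨hS.connected hG hne, hc⟩
    obtain ⟨A, C, h, hA, hC, rfl⟩ := exists_isSplitAt hv hcut
    have hSA := h.isGeodesicallyConvex hG hS
    have hSC := h.symm.isGeodesicallyConvex hG (by rwa [Finset.union_comm])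
    have hcard : (insert v (A ∪ C)).card = A.card + C.card + 1 := by
      rw [Finset.card_insert_of_notMem (by simp [h.notMem_left, h.notMem_right]),
        Finset.card_union_of_disjoint h.disjoint]
    have hcardA := Finset.card_insert_of_notMem h.notMem_left
    have hcardC := Finset.card_insert_of_notMem h.notMem_right
    have := hA.card_pos
    have := hC.card_pos
    obtain ⟨𝔄, hA₁, hA₂, hA₃, hA₄⟩ := ih _ (by omega) (insert v A) hSA (by simp) rfl
    obtain ⟨ℭ, hC₁, hC₂, hC₃, hC₄⟩ := ih _ (by omega) (insert v C) hSC (by simp) rfl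
    -- A block common to both sides would have no vertex other than `v`.
    have hdisj : Disjoint 𝔄 ℭ := by
      refine Finset.disjoint_left.2 fun T hTA hTC => ?_
      have h1 := (hA₁ _).2 ⟨T, hTA, rfl⟩
      have h2 := (hC₁ _).2 ⟨T, hTC, rfl⟩
      refine h1.not_verts_subset_singleton hG h.notMem_left hA hSA fun x hx => ?_
      rcases Finset.mem_insert.1 (h1.1.2 hx) with h1 | h1
      · exact h1
      · exact (Finset.mem_insert.1 (h2.1.2 hx)).resolve_right
          (Finset.disjoint_left.1 h.disjoint h1)
    refine ⟨𝔄 ∪ ℭ, fun H => ?_, fun T hT => ?_, ?_, fun u hu => ⟨fun w hw => ?_, ?_⟩⟩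
    · rw [h.isBlockIn_iff hG hA hC hS, hA₁, hC₁]
      simp only [Finset.mem_union, or_and_right, exists_or]
    · exact (Finset.mem_union.1 hT).elim (hA₂ T) (hC₂ T)
    · rw [Finset.sum_union hdisj, Finset.card_union_of_disjoint hdisj]
      omega
    · obtain ⟨hA₄, -⟩ := hA₄ u fun T hT => hu T (Finset.mem_union_left _ hT)
      obtain ⟨hC₄, -⟩ := hC₄ u fun T hT => hu T (Finset.mem_union_right _ hT)
      rw [qCofactorOn_eq q hw hv, h.qCofactorOn hG hS, Finset.prod_union hdisj,
        hA₄ v (by simp), hC₄ v (by simp)]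
    · obtain ⟨hA₄, hA₅⟩ := hA₄ u fun T hT => hu T (Finset.mem_union_left _ hT)
      obtain ⟨hC₄, hC₅⟩ := hC₄ u fun T hT => hu T (Finset.mem_union_right _ hT)
      rw [h.detOn hG hS, hA₅, hC₅, hA₄ v (by simp), hC₄ v (by simp), Finset.sum_union hdisj,
        Finset.sum_mul, Finset.mul_sum]
      congr 1
      · refine Finset.sum_congr rfl fun T hT => ?_
        rw [Finset.erase_union_distrib, Finset.erase_eq_of_notMem (s := ℭ)
          (Finset.disjoint_left.1 hdisj hT), Finset.prod_union
          (hdisj.mono_left (Finset.erase_subset _ _)), mul_assoc]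
      · refine Finset.sum_congr rfl fun T hT => ?_
        rw [Finset.erase_union_distrib, Finset.erase_eq_of_notMem (s := 𝔄)
          (Finset.disjoint_right.1 hdisj hT), Finset.prod_union
          (hdisj.mono_right (Finset.erase_subset _ _))]
        ring

end Determinants

end SimpleGraph

namespace SimpleGraph

open Matrix

/-! ### Complete bipartite graphs -/

section CompleteBipartite

variable {α β : Type*}

theorem completeBipartiteGraph_dist_inl_inr (a : α) (b : β) :
    (completeBipartiteGraph α β).dist (.inl a) (.inr b) = 1 :=
  dist_eq_one_iff_adj.2 (by simp)

theorem completeBipartiteGraph_dist_inl_inl [Nonempty β] {a a' : α} (h : a ≠ a') :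
    (completeBipartiteGraph α β).dist (.inl a) (.inl a') = 2 := by
  obtain ⟨b⟩ := ‹Nonempty β›
  have h₁ : (completeBipartiteGraph α β).Adj (.inl a) (.inr b) := by simp
  have h₂ : (completeBipartiteGraph α β).Adj (.inr b) (.inl a') := by simp
  have hr : (completeBipartiteGraph α β).Reachable (.inl a) (.inl a') :=
    h₁.reachable.trans h₂.reachable
  refine le_antisymm (dist_le (.cons h₁ (.cons h₂ .nil))) ?_
  exact hr.one_lt_dist_of_ne_of_not_adj (by simpa using h) (by simp)

theorem completeBipartiteGraph_dist_inr_inr [Nonempty α] {b b' : β} (h : b ≠ b') :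
    (completeBipartiteGraph α β).dist (.inr b) (.inr b') = 2 := by
  obtain ⟨a⟩ := ‹Nonempty α›
  have h₁ : (completeBipartiteGraph α β).Adj (.inr b) (.inl a) := by simp
  have h₂ : (completeBipartiteGraph α β).Adj (.inl a) (.inr b') := by simp
  have hr : (completeBipartiteGraph α β).Reachable (.inr b) (.inr b') :=
    h₁.reachable.trans h₂.reachable
  refine le_antisymm (dist_le (.cons h₁ (.cons h₂ .nil))) ?_
  exact hr.one_lt_dist_of_ne_of_not_adj (by simpa using h) (by simp)

variable {R : Type*} [CommRing R]

/-- The matrix whose two columns are the indicators of the two sides of a bipartition. -/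
def sideIndicator (α β R : Type*) [CommRing R] : Matrix (α ⊕ β) (Fin 2) R :=
  of (Sum.elim (fun _ => ![1, 0]) (fun _ => ![0, 1]))

theorem sideIndicator_transpose_mul_self [Fintype α] [Fintype β] :
    (sideIndicator α β R)ᵀ * sideIndicator α β R =
    !![(Fintype.card α : R), 0; 0, (Fintype.card β : R)] := by
  ext i j
  fin_cases i <;> fin_cases j <;> simp [sideIndicator, mul_apply]

theorem mul_fin_two_mul_transpose_apply {ι : Type*} (U : Matrix ι (Fin 2) R) (a b c d : R)
    (i j : ι) : (U * (!![a, b; c, d] * Uᵀ)) i j =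
      U i 0 * (a * U j 0 + b * U j 1) + U i 1 * (c * U j 0 + d * U j 1) := by
  simp only [mul_apply, Fin.sum_univ_two, transpose_apply]
  rfl

variable [Fintype α] [Fintype β] [DecidableEq α] [DecidableEq β] [Nonempty α] [Nonempty β]

theorem completeBipartiteGraph_qDistMatrix (q : R) :
    (completeBipartiteGraph α β).qDistMatrix q =
      sideIndicator α β R * (!![q + 1, 1; 1, q + 1] * (sideIndicator α β R)ᵀ) -
        scalar (α ⊕ β) (q + 1) := by
  ext (i | i) (j | j) <;> rw [Matrix.sub_apply, mul_fin_two_mul_transpose_apply]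
  · by_cases h : i = j
    · subst h
      simp [qDistMatrix, sideIndicator, scalar_apply]
    · simp [qDistMatrix, sideIndicator, scalar_apply, h, completeBipartiteGraph_dist_inl_inl h,
        Finset.sum_range_succ, add_comm]
  · simp [qDistMatrix, sideIndicator, scalar_apply, completeBipartiteGraph_dist_inl_inr]
  · simp [qDistMatrix, sideIndicator, scalar_apply, dist_comm (u := Sum.inr i),
      completeBipartiteGraph_dist_inl_inr]
  · by_cases h : i = j
    · subst h
      simp [qDistMatrix, sideIndicator, scalar_apply]
    · simp [qDistMatrix, sideIndicator, scalar_apply, h, completeBipartiteGraph_dist_inr_inr h,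
        Finset.sum_range_succ, add_comm]

/-- The matrix is a matrix of rank at most two minus a scalar, so that its determinant is a value
of the characteristic polynomial of a `2 × 2` matrix. -/
theorem completeBipartiteGraph_det_qDistMatrix (q : R) :
    ((completeBipartiteGraph α β).qDistMatrix q).det =
      (-1) ^ (Fintype.card α + Fintype.card β - 2) *
        (q + 1) ^ (Fintype.card α + Fintype.card β - 2) *
        ((q + 1) ^ 2 * ((Fintype.card α : R) - 1) * ((Fintype.card β : R) - 1) -
          (Fintype.card α : R) * (Fintype.card β : R)) := by
  have hα : 0 < Fintype.card α := Fintype.card_pos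
  have hβ : 0 < Fintype.card β := Fintype.card_pos
  have hle : Fintype.card (Fin 2) ≤ Fintype.card (α ⊕ β) := by simp; omega
  have key := congrArg (Polynomial.eval (q + 1)) (charpoly_mul_comm_of_le (sideIndicator α β R)
    (!![q + 1, 1; 1, q + 1] * (sideIndicator α β R)ᵀ) hle)
  rw [eval_charpoly, ← neg_sub, ← completeBipartiteGraph_qDistMatrix, det_neg,
    Polynomial.eval_mul, Polynomial.eval_pow, Polynomial.eval_X, eval_charpoly, Matrix.mul_assoc,
    sideIndicator_transpose_mul_self, det_fin_two] at key
  simp only [Fintype.card_sum, Fintype.card_fin] at key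
  obtain ⟨N, hN⟩ : ∃ N, Fintype.card α + Fintype.card β = N + 2 :=
    ⟨Fintype.card α + Fintype.card β - 2, by omega⟩
  rw [hN, Nat.add_sub_cancel] at key ⊢
  have h1 : ((-1 : R) ^ N) * (-1) ^ N = 1 := by rw [← mul_pow]; simp
  have h2 := congrArg (fun x => (-1 : R) ^ N * x) key
  simp only [pow_add, even_two, Even.neg_pow, one_pow, mul_one, ← mul_assoc, h1, one_mul] at h2
  rw [h2]
  simp [scalar_apply]
  ring

end CompleteBipartite

/-! ### Transfer along distance-preserving maps -/

section Transfer

variable {V W : Type*} [DecidableEq V] [Fintype W] [DecidableEq W] {R : Type*} [CommRing R]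
  {G : SimpleGraph V} {H : SimpleGraph W} {S : Finset V} (f : W → V)

/-- If `f` embeds `H` isometrically into `G` with image `S`, then the principal submatrix of the
`q`-distance matrix of `G` on `S` has the determinant of the `q`-distance matrix of `H`. -/
theorem detOn_qDistMatrix_eq (hf : Function.Injective f) (hS : ∀ x, x ∈ S ↔ ∃ k, f k = x)
    (hd : ∀ i j, H.dist i j = G.dist (f i) (f j)) (q : R) :
    (G.qDistMatrix q).detOn S = (H.qDistMatrix q).det :=
  detOn_eq_det f hf hS fun i j => by simp [qDistMatrix, hd]

theorem qCofactorOn_eq_qCofactor (hf : Function.Injective f) (hS : ∀ x, x ∈ S ↔ ∃ k, f k = x)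
    (hd : ∀ i j, H.dist i j = G.dist (f i) (f j)) (q : R) (v : W) :
    G.qCofactorOn q S (f v) = H.qCofactor q v := by
  refine detOn_eq_det (fun w : {w // w ≠ v} => f w) (hf.comp Subtype.val_injective)
    (fun x => ?_) fun i j => ?_
  · rw [Finset.mem_erase, hS]
    constructor
    · rintro ⟨hne, k, rfl⟩
      exact ⟨⟨k, fun h => hne (congrArg f h)⟩, rfl⟩
    · rintro ⟨k, rfl⟩
      exact ⟨fun h => k.2 (hf h), k, rfl⟩
  · have hD : ∀ i j, H.qDistMatrix q i j = G.qDistMatrix q (f i) (f j) := fun i j => by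
      simp [qDistMatrix, hd]
    simp [qDistReduced, qDistRowReduced, i.2, j.2, qReduce, hD, qDistMatrix_self,
      one_add_mul_qDistMatrix, hd]

end Transfer

/-! ### The cofactor of a complete bipartite graph -/

section CompleteBipartite

variable {α β R : Type*} [CommRing R] [Fintype α] [Fintype β] [DecidableEq α] [DecidableEq β]

/-- With a pivot on the first side, the reduced matrix is `-(q + 1)` times a perturbation of the
identity of rank at most two, and the Weinstein–Aronszajn identity applies. -/
theorem completeBipartiteGraph_qCofactorOn_inl [Nonempty β] (q : R) (a : α) :
    (completeBipartiteGraph α β).qCofactorOn q Finset.univ (.inl a) =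
      (-1) ^ (Fintype.card α + Fintype.card β - 2) *
        (q + 1) ^ (Fintype.card α + Fintype.card β - 1) *
        (q ^ 2 * ((Fintype.card α : R) - 1) * ((Fintype.card β : R) - 1) - 1) := by
  have : Nonempty α := ⟨a⟩
  let U : Matrix {w : α ⊕ β // w ≠ .inl a} (Fin 2) R :=
    (sideIndicator α β R).submatrix Subtype.val id
  have hU : Uᵀ * U = !![(Fintype.card α : R) - 1, 0; 0, (Fintype.card β : R)] := by
    have key : ∀ i j, (Uᵀ * U) i j = ((sideIndicator α β R)ᵀ * sideIndicator α β R) i j -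
        sideIndicator α β R (.inl a) i * sideIndicator α β R (.inl a) j := by
      intro i j
      rw [mul_apply, mul_apply, Fintype.sum_eq_add_sum_subtype_ne _ (Sum.inl a)]
      simp [U]
    ext i j
    rw [key, sideIndicator_transpose_mul_self]
    fin_cases i <;> fin_cases j <;> simp [sideIndicator]
  have hM : (((completeBipartiteGraph α β).qDistMatrix q).qReduce q (.inl a)).submatrix
      (Subtype.val : {w : α ⊕ β // w ≠ .inl a} → α ⊕ β) Subtype.val =
      (-(q + 1)) • (1 + U * (!![q ^ 2, q; q, 0] * Uᵀ)) := by
    rw [completeBipartiteGraph_qDistMatrix]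
    ext ⟨i, hi⟩ ⟨j, hj⟩
    rw [submatrix_apply, qReduce, of_apply, Matrix.smul_apply, Matrix.add_apply, mul_fin_two_mul_transpose_apply]
    simp only [Matrix.sub_apply, mul_fin_two_mul_transpose_apply]
    rcases i with i | i <;> rcases j with j | j
    · have hi' : i ≠ a := fun h => hi (by rw [h])
      have hj' : a ≠ j := fun h => hj (by rw [h])
      by_cases h : i = j
      · subst h
        simp [U, sideIndicator, scalar_apply, hi', hj']
        ring
      · simp [U, sideIndicator, scalar_apply, hi', hj', h, one_apply]
        ring
    · have hi' : i ≠ a := fun h => hi (by rw [h])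
      simp [U, sideIndicator, scalar_apply, hi', one_apply]
      ring
    · have hj' : a ≠ j := fun h => hj (by rw [h])
      simp [U, sideIndicator, scalar_apply, hj', one_apply]
      ring
    · by_cases h : i = j
      · subst h
        simp [U, sideIndicator, scalar_apply]
        ring
      · simp [U, sideIndicator, scalar_apply, h, one_apply]
  have hcard : Fintype.card {w : α ⊕ β // w ≠ .inl a} = Fintype.card α + Fintype.card β - 1 := by
    simp [Fintype.card_subtype_compl]
  have hα : 0 < Fintype.card α := Fintype.card_pos
  have hβ : 0 < Fintype.card β := Fintype.card_pos
  rw [qCofactorOn, detOn_eq_det (N := submatrix _ _ _)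
    (Subtype.val : {w : α ⊕ β // w ≠ .inl a} → α ⊕ β) Subtype.val_injective (by simp)
    (fun _ _ => submatrix_apply _ _ _ _ _), hM, det_smul, hcard, det_one_add_mul_comm,
    Matrix.mul_assoc, hU, det_fin_two]
  obtain ⟨N, hN⟩ : ∃ N, Fintype.card α + Fintype.card β = N + 2 :=
    ⟨Fintype.card α + Fintype.card β - 2, by omega⟩
  rw [hN, Nat.add_sub_cancel, show N + 2 - 1 = N + 1 by omega, neg_pow, pow_succ (-1 : R) N]
  simp
  ring

/-- The cofactor formula holds for every pivot, the cofactor being independent of it. -/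
theorem completeBipartiteGraph_qCofactorOn [Nonempty α] [Nonempty β] (q : R) (v : α ⊕ β) :
    (completeBipartiteGraph α β).qCofactorOn q Finset.univ v =
      (-1) ^ (Fintype.card α + Fintype.card β - 2) *
        (q + 1) ^ (Fintype.card α + Fintype.card β - 1) *
        (q ^ 2 * ((Fintype.card α : R) - 1) * ((Fintype.card β : R) - 1) - 1) := by
  obtain ⟨a⟩ := ‹Nonempty α›
  rw [qCofactorOn_eq q (Finset.mem_univ v) (Finset.mem_univ (.inl a)),
    completeBipartiteGraph_qCofactorOn_inl]

end CompleteBipartite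

/-! ### The block decomposition of a connected graph -/

section Blocks

theorem isBlockIn_univ_iff {V : Type*} [Fintype V] {G : SimpleGraph V} (H : G.Subgraph) : G.IsBlockIn Finset.univ H ↔ H.IsBlock := by
  simp [IsBlockIn, Subgraph.IsBlock]

variable {V : Type*} [Fintype V] [DecidableEq V] {R : Type*} [CommRing R] {G : SimpleGraph V}

/-- The Graham–Hoffman–Hosoya theorem for `q`-distances in a connected graph whose blocks are
`B i`, for `i : ι`. -/
theorem Connected.qDistMatrix_blocks (hG : G.Connected) (q : R) {ι : Type*} [Fintype ι]
    [DecidableEq ι] (B : ι → G.Subgraph) [∀ i, Fintype (B i).verts]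
    (hB_inj : Function.Injective B) (hB : ∀ H : G.Subgraph, H.IsBlock ↔ ∃ i, B i = H) :
    Fintype.card V + Fintype.card ι = ∑ i, Fintype.card (B i).verts + 1 ∧
    ∀ u : ∀ i, (B i).verts,
      (∀ v, G.qCofactor q v = ∏ i, (B i).coe.qCofactor q (u i)) ∧
      (G.qDistMatrix q).det = ∑ i, ((B i).coe.qDistMatrix q).det *
        ∏ j ∈ Finset.univ.erase i, (B j).coe.qCofactor q (u j) := by
  classical
  have := hG.nonempty
  obtain ⟨𝔅, h₁, h₂, h₃, h₄⟩ := IsGeodesicallyConvex.exists_blocks hG q (Finset.univ : Finset V)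
    (fun _ _ _ _ _ _ => Finset.mem_univ _) Finset.univ_nonempty
  simp only [isBlockIn_univ_iff] at h₁
  let t : ι → Finset V := fun i => (B i).verts.toFinset
  have ht : ∀ i, t i ∈ 𝔅 ∧ B i = (⊤ : G.Subgraph).induce (t i) := by
    intro i
    obtain ⟨T, hT, hBT⟩ := (h₁ (B i)).1 ((hB _).2 ⟨i, rfl⟩)
    have : t i = T := by
      ext x
      simp [t, hBT]
    rw [this]
    exact ⟨hT, hBT⟩
  have ht_inj : Function.Injective t := fun i j hij => hB_inj (by
    rw [(ht i).2, (ht j).2, hij])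
  have h𝔅 : 𝔅 = Finset.univ.image t := by
    ext T
    simp only [Finset.mem_image, Finset.mem_univ, true_and]
    constructor
    · intro hT
      obtain ⟨i, hi⟩ := (hB _).1 ((h₁ _).2 ⟨T, hT, rfl⟩)
      refine ⟨i, ?_⟩
      ext x
      simp [t, hi]
    · rintro ⟨i, rfl⟩
      exact (ht i).1
  have hmem : ∀ i x, x ∈ t i ↔ ∃ k : (B i).verts, k.1 = x := fun i x => by simp [t]
  have hdist : ∀ i (x y : (B i).verts), (B i).coe.dist x y = G.dist x y := by
    intro i
    have key : ∀ K : G.Subgraph, K = (⊤ : G.Subgraph).induce (t i) →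
        ∀ x y : K.verts, K.coe.dist x y = G.dist x y := by
      rintro K rfl
      exact (h₂ _ (ht i).1).dist_coe hG
    exact key _ (ht i).2
  have hdet : ∀ i, (G.qDistMatrix q).detOn (t i) = ((B i).coe.qDistMatrix q).det := fun i =>
    detOn_qDistMatrix_eq Subtype.val Subtype.val_injective (hmem i) (hdist i) q
  have hcof : ∀ i (x : (B i).verts), G.qCofactorOn q (t i) x = (B i).coe.qCofactor q x := fun i =>
    qCofactorOn_eq_qCofactor Subtype.val Subtype.val_injective (hmem i) (hdist i) q
  refine ⟨?_, fun u => ?_⟩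
  · rw [h𝔅, Finset.sum_image ht_inj.injOn, Finset.card_image_of_injective _ ht_inj] at h₃
    simpa [t, Set.toFinset_card] using h₃
  -- The pivots `u i` are turned into a function of the vertex sets; its value elsewhere is
  -- irrelevant.
  · let u' : Finset V → V := Function.extend t (fun i => (u i).1) (fun _ => Classical.arbitrary V)
    have hu' : ∀ i, u' (t i) = u i := fun i => ht_inj.extend_apply _ _ i
    obtain ⟨h₅, h₆⟩ := h₄ u' (by
      rw [h𝔅]
      intro T hT
      obtain ⟨i, -, rfl⟩ := Finset.mem_image.1 hT
      rw [hu', hmem]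
      exact ⟨_, rfl⟩)
    constructor
    · intro v
      have h := h₅ v (Finset.mem_univ v)
      rw [h𝔅, Finset.prod_image ht_inj.injOn] at h
      simp only [hu', hcof] at h
      rw [← h]
      exact (qCofactorOn_eq_qCofactor id Function.injective_id (by simp) (fun _ _ => rfl) q v).symm
    · rw [h𝔅, Finset.sum_image ht_inj.injOn] at h₆
      simp only [← Finset.image_erase ht_inj, Finset.prod_image ht_inj.injOn, hu', hcof,
        hdet] at h₆
      rw [← h₆]
      exact (detOn_qDistMatrix_eq id Function.injective_id (by simp) (fun _ _ => rfl) q).symm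

end Blocks

/-! ### Graphs isomorphic to a complete bipartite graph -/

section IsCompleteBipartiteOn

variable {W : Type*} {H : SimpleGraph W} {m n : ℕ}

theorem IsCompleteBipartiteOn.pos_of_adj (h : H.IsCompleteBipartiteOn m n) {x y : W}
    (hxy : H.Adj x y) : 0 < m ∧ 0 < n := by
  obtain ⟨φ⟩ := h
  have := φ.map_adj_iff.2 hxy
  rcases hx : φ x with a | a <;> rcases hy : φ y with b | b <;> simp [hx, hy] at this
  exacts [⟨a.pos, b.pos⟩, ⟨b.pos, a.pos⟩]

theorem IsCompleteBipartiteOn.exists_adj (h : H.IsCompleteBipartiteOn m n) (hm : 0 < m)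
    (hn : 0 < n) : ∃ x y, H.Adj x y := by
  obtain ⟨φ⟩ := h
  exact ⟨φ.symm (.inl ⟨0, hm⟩), φ.symm (.inr ⟨0, hn⟩), φ.symm.map_adj_iff.2 (by simp)⟩

theorem dist_map_iso {W' : Type*} {H' : SimpleGraph W'} (φ : H ≃g H') (x y : W) :
    H'.dist (φ x) (φ y) = H.dist x y := by
  simp only [dist_eq_sInf]
  congr 1
  ext k
  constructor
  · rintro ⟨p, rfl⟩
    exact ⟨(p.map φ.symm.toHom).copy (by simp) (by simp), by simp⟩
  · rintro ⟨p, rfl⟩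
    exact ⟨p.map φ.toHom, by simp⟩

theorem IsCompleteBipartiteOn.card [Fintype W] (h : H.IsCompleteBipartiteOn m n) :
    Fintype.card W = m + n := by
  obtain ⟨φ⟩ := h
  simpa using Fintype.card_congr φ.toEquiv

variable [Fintype W] [DecidableEq W] {R : Type*} [CommRing R]

theorem IsCompleteBipartiteOn.det_qDistMatrix (h : H.IsCompleteBipartiteOn m n) (hm : 0 < m)
    (hn : 0 < n) (q : R) : (H.qDistMatrix q).det =
      (-1) ^ (m + n - 2) * (q + 1) ^ (m + n - 2) *
        ((q + 1) ^ 2 * ((m : R) - 1) * ((n : R) - 1) - (m : R) * (n : R)) := by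
  obtain ⟨φ⟩ := h
  have : Nonempty (Fin m) := ⟨⟨0, hm⟩⟩
  have : Nonempty (Fin n) := ⟨⟨0, hn⟩⟩
  have h := completeBipartiteGraph_det_qDistMatrix (α := Fin m) (β := Fin n) q
  rw [Fintype.card_fin, Fintype.card_fin] at h
  rw [← h, ← det_submatrix_equiv_self φ.toEquiv]
  congr 1
  ext i j
  simp [qDistMatrix, dist_map_iso]

theorem IsCompleteBipartiteOn.qCofactor (h : H.IsCompleteBipartiteOn m n) (hm : 0 < m)
    (hn : 0 < n) (q : R) (v : W) : H.qCofactor q v =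
      (-1) ^ (m + n - 2) * (q + 1) ^ (m + n - 1) *
        (q ^ 2 * ((m : R) - 1) * ((n : R) - 1) - 1) := by
  obtain ⟨φ⟩ := h
  have : Nonempty (Fin m) := ⟨⟨0, hm⟩⟩
  have : Nonempty (Fin n) := ⟨⟨0, hn⟩⟩
  have h := completeBipartiteGraph_qCofactorOn (α := Fin m) (β := Fin n) q (φ v)
  rw [Fintype.card_fin, Fintype.card_fin] at h
  rw [← h]
  exact (qCofactorOn_eq_qCofactor φ φ.injective (fun x => by simp [φ.surjective x])
    (fun i j => (dist_map_iso φ i j).symm) q v).symm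

end IsCompleteBipartiteOn

end SimpleGraph

theorem mainTheorem1 {V : Type*} [Fintype V] [DecidableEq V] {R : Type*} [CommRing R]
    (G : SimpleGraph V) (hG : G.IsBiBlock)
    (r : ℕ) (hr : 1 < r)
    (B : Fin r → G.Subgraph) [∀ i, Fintype (B i).verts]
    (hB_inj : Function.Injective B)
    (hB : ∀ H : G.Subgraph, H.IsBlock ↔ ∃ i, B i = H)
    (m n : Fin r → ℕ)
    (hmn : ∀ i, (B i).coe.IsCompleteBipartiteOn (m i) (n i))
    (q : R) (hq : q ≠ -1) :
    (Fintype.card V : ℤ) = ∑ i, ((m i : ℤ) + n i) - r + 1 ∧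
    (∀ v : V, G.qCofactor q v =
      ∏ i, (-1) ^ (m i + n i - 2) * (q + 1) ^ (m i + n i - 1) *
        (q ^ 2 * ((m i : R) - 1) * ((n i : R) - 1) - 1)) ∧
    (∀ u : ∀ i, (B i).verts, (G.qDistMatrix q).det =
      ∑ i, ((B i).coe.qDistMatrix q).det *
        ∏ j ∈ Finset.univ.erase i, (B j).coe.qCofactor q (u j)) ∧
    (∀ i, ((B i).coe.qDistMatrix q).det =
      (-1) ^ (m i + n i - 2) * (q + 1) ^ (m i + n i - 2) *
        ((q + 1) ^ 2 * ((m i : R) - 1) * ((n i : R) - 1) - (m i : R) * (n i : R))) ∧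
    (∀ j, ∀ u : (B j).verts, (B j).coe.qCofactor q u =
      (-1) ^ (m j + n j - 2) * (q + 1) ^ (m j + n j - 1) *
        (q ^ 2 * ((m j : R) - 1) * ((n j : R) - 1) - 1)) := by

  obtain ⟨hconn, hbi⟩ := hG
  -- Both sides are nonempty: the block has an edge, being isomorphic to some `K_{m',n'}` with
  -- `m', n' ≥ 1`.
  have hpos : ∀ i, 0 < m i ∧ 0 < n i := by
    intro i
    obtain ⟨m', n', hm', hn', h⟩ := hbi (B i) ((hB _).2 ⟨i, rfl⟩)
    obtain ⟨x, y, hxy⟩ := h.exists_adj hm' hn'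
    exact (hmn i).pos_of_adj hxy
  have hdet := fun i => (hmn i).det_qDistMatrix (hpos i).1 (hpos i).2 q
  have hcof := fun i => (hmn i).qCofactor (hpos i).1 (hpos i).2 q
  obtain ⟨hcard, hmain⟩ := hconn.qDistMatrix_blocks q B hB_inj hB
  refine ⟨?_, fun v => ?_, fun u => (hmain u).2, hdet, hcof⟩
  · simp only [fun i => (hmn i).card, Fintype.card_fin] at hcard
    have h : (Fintype.card V : ℤ) + r = ∑ i, ((m i : ℤ) + n i) + 1 := by exact_mod_cast hcard
    linarith
  · have hu : ∀ i, Nonempty (B i).verts := fun i =>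
      ((hB _).2 ⟨i, rfl⟩).1.1.nonempty.to_subtype
    rw [(hmain fun i => (hu i).some).1 v]
    exact Finset.prod_congr rfl fun i _ => hcof i _
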